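/- Let $\Gamma\subset\mathbb C^n$ be a compact, smooth, real-algebraic hypersurface: $\Gamma$ is compact, near each of its points it is the zero set of a real-valued $C^\infty$ function with non-vanishing differential at that point, and there is a polynomial $P(z,\zeta)$ in $2n$ complex variables, with $P(z,\overline z)$ real for all $z\in\mathbb C^n$, such that $\Gamma=\{z\in\mathbb C^n : P(z,\overline z)=0\}$. For $w\in\mathbb C^n$ let $$Q_w=\{z\in\mathbb C^n : P(z,\overline w)=0\},\qquad I_w=\{z\in\mathbb C^n : Q_z=Q_w\}$$ be the Segre variety of $w$ and the set of points with the same Segre variety as $w$, taken with respect to $P$. Then there exist an open neighborhood $U$ of $\Gamma$ and an integer $m\ge 1$ such that $\# I_z=m$ for almost every $z\in U$ (with respect to Lebesgue measure). -/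

import Mathlib

open MeasureTheory
open scoped ContDiff

/-- Polynomials `P(z, ζ)` in two groups of `n` complex variables: `Sum.inl i` stands for `z_i`
and `Sum.inr i` for `ζ_i`.  Substituting `ζ = z̄` gives the polynomials in `z, z̄`; substituting
`ζ = w̄` gives their complexification. -/
abbrev PolarPoly (n : ℕ) : Type := MvPolynomial (Fin n ⊕ Fin n) ℂ

/-- The complexified value `P(z, w̄)`. -/
noncomputable def PolarPoly.polarEval {n : ℕ} (P : PolarPoly n) (z w : Fin n → ℂ) : ℂ :=
  MvPolynomial.eval (Sum.elim z (star w)) P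

/-- `P(z, z̄)` is real for every `z`, that is, `P` is a real polynomial on `ℂⁿ = ℝ²ⁿ`. -/
def PolarPoly.IsReal {n : ℕ} (P : PolarPoly n) : Prop :=
  ∀ z : Fin n → ℂ, (P.polarEval z z).im = 0

/-- The real zero locus `{z ∈ ℂⁿ : P(z, z̄) = 0}`. -/
def PolarPoly.realZeroLocus {n : ℕ} (P : PolarPoly n) : Set (Fin n → ℂ) :=
  {z | P.polarEval z z = 0}

/-- The Segre variety `Q_w = {z ∈ ℂⁿ : P(z, w̄) = 0}`. -/
def PolarPoly.segreVariety {n : ℕ} (P : PolarPoly n) (w : Fin n → ℂ) : Set (Fin n → ℂ) :=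
  {z | P.polarEval z w = 0}

/-- `I_w = {z ∈ ℂⁿ : Q_z = Q_w}`, the fibre through `w` of the Segre map `z ↦ Q_z`. -/
def PolarPoly.segreFiber {n : ℕ} (P : PolarPoly n) (w : Fin n → ℂ) : Set (Fin n → ℂ) :=
  {z | P.segreVariety z = P.segreVariety w}

/-- `Γ ⊆ ℂⁿ` is a smooth (embedded) real hypersurface: near each of its points it is the zero set
of a real-valued smooth function whose differential does not vanish at that point. -/
def IsSmoothRealHypersurface {n : ℕ} (Γ : Set (Fin n → ℂ)) : Prop :=
  ∀ p ∈ Γ, ∃ (V : Set (Fin n → ℂ)) (ρ : (Fin n → ℂ) → ℝ),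
    IsOpen V ∧ p ∈ V ∧ ContDiffOn ℝ ∞ ρ V ∧ fderiv ℝ ρ p ≠ 0 ∧ ∀ q ∈ V, q ∈ Γ ↔ ρ q = 0

/-! Let `K` be the countable field generated by the coefficients of `P`. Call `z` generic if the
coordinates of `z̄` are algebraically independent over `K`; almost every `z` is. Any two generic
points are related, after conjugation, by an automorphism of `ℂ` over `K`. It permutes the Segre
varieties, so `#I_z` has one value, possibly infinite, at all generic points
(`PolarPoly.encard_segreFiber_eq_of_ringEquiv`).

Finiteness is thus needed at a single generic point, and `Γ`, being a real hypersurface, contains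
one (`IsSmoothRealHypersurface.exists_eval_ne_zero`). For `q ∈ Γ`, if `Q_q ⊆ Q_w` then `q ∈ Q_q ⊆
Q_w`, so by Hermitian symmetry `w ∈ Q_q ⊆ Q_w`, that is, `w ∈ Γ`. The conjugates of such `w` form a
bounded algebraic set, which is finite. Hence `U` can be all of `ℂⁿ`. -/

/-! ### Null and bounded algebraic sets. -/

open MvPolynomial in
/-- The zero set of a nonzero complex polynomial is Lebesgue null. -/
theorem MvPolynomial.volume_zeros_eq_zero {n : ℕ} {f : MvPolynomial (Fin n) ℂ} (hf : f ≠ 0) :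
    volume {x : Fin n → ℂ | eval x f = 0} = 0 := by
  induction n with
  | zero =>
    convert measure_empty (μ := (volume : Measure (Fin 0 → ℂ)))
    ext x
    simp only [Set.mem_ofPred_eq, Set.mem_empty_iff_false, iff_false]
    rw [MvPolynomial.eq_C_of_isEmpty f] at hf ⊢
    simpa using hf
  | succ n ih =>
    have hmeas : MeasurableSet {x : Fin (n + 1) → ℂ | eval x f = 0} :=
      (isClosed_eq (MvPolynomial.continuous_eval f) continuous_const).measurableSet
    have hmp := (volume_preserving_piFinSuccAbove (fun _ : Fin (n + 1) => ℂ) 0).symm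
    rw [← hmp.measure_preimage hmeas.nullMeasurableSet, Measure.volume_eq_prod,
      Measure.measure_prod_null (hmp.measurable hmeas)]
    have hF : finSuccEquiv ℂ n f ≠ 0 := by simpa using hf
    -- With `f` read as a polynomial in its first variable, only finitely many constants are roots;
    -- every other slice is null by induction, and Fubini concludes.
    have hfin : {c : ℂ | Polynomial.eval (C c) (finSuccEquiv ℂ n f) = 0}.Finite :=
      Set.Finite.preimage (C_injective _ _).injOn
        (Polynomial.finite_setOfPred_isRoot hF)
    have hae : ∀ᵐ c : ℂ, Polynomial.eval (C c) (finSuccEquiv ℂ n f) ≠ 0 := by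
      rw [ae_iff]
      simpa using hfin.measure_zero volume
    filter_upwards [hae] with c hc
    refine (congrArg volume (Set.ext fun y => ?_)).trans (ih hc)
    simp only [Set.mem_preimage, Set.mem_ofPred_eq]
    rw [eval_polynomial_eval_finSuccEquiv, eval_C]
    have hcons : (MeasurableEquiv.piFinSuccAbove (fun _ : Fin (n + 1) => ℂ) 0).symm (c, y) =
        Fin.cons c y := Fin.insertNth_zero' c y
    rw [hcons]
    rfl

open MvPolynomial in
/-- A bounded algebraic subset of affine space over `ℂ` is finite. -/
theorem MvPolynomial.finite_zeroLocus_of_isCompact {n : ℕ} (I : Ideal (MvPolynomial (Fin n) ℂ))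
    {K : Set (Fin n → ℂ)} (hK : IsCompact K) (hI : zeroLocus ℂ I ⊆ K) :
    (zeroLocus ℂ I).Finite := by
  by_cases htop : I = ⊤
  · subst htop
    rw [zeroLocus_top]
    exact Set.finite_empty
  obtain ⟨s, -, g, hinj, hint⟩ := exists_integral_inj_algHom_of_quotient I htop
  -- `s` counts the Noether normalization parameters. With none, each coordinate is integral over
  -- `ℂ` and takes finitely many values; otherwise a parameter takes every value, by lying over, and
  -- is unbounded.
  obtain _ | s := s
  · have key : ∀ i : Fin n, {c : ℂ | ∃ x ∈ zeroLocus ℂ I, x i = c}.Finite := by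
      intro i
      obtain ⟨p, hp, hroot⟩ := hint (Ideal.Quotient.mk I (X i))
      let e : MvPolynomial (Fin 0) ℂ →ₐ[ℂ] ℂ := aeval finZeroElim
      refine (Polynomial.finite_setOfPred_isRoot (hp.map (e : _ →+* ℂ)).ne_zero).subset ?_
      rintro _ ⟨x, hx, rfl⟩
      let φ : (MvPolynomial (Fin n) ℂ ⧸ I) →ₐ[ℂ] ℂ := Ideal.Quotient.liftₐ I (aeval x) hx
      have hφ : φ.comp g = e := by ext i; exact i.elim0
      have h3 : φ (Ideal.Quotient.mk I (X i)) = x i := by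
        change aeval x (X i) = x i
        simp
      have h4 : φ.toRingHom.comp g.toRingHom = (e : _ →+* ℂ) := by
        rw [← hφ]; rfl
      have h := congrArg φ.toRingHom hroot
      rw [Polynomial.hom_eval₂, map_zero] at h
      simp only [Set.mem_ofPred_eq, Polynomial.IsRoot.def, Polynomial.eval_map]
      rw [← h4, ← h3]
      exact h
    exact (Set.Finite.pi key).subset fun x hx i _ => ⟨x, hx, rfl⟩
  · exfalso
    obtain ⟨G, hG⟩ := Ideal.Quotient.mk_surjective (g (X 0))
    obtain ⟨B, hB⟩ := hK.exists_bound_of_continuousOn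
      (MvPolynomial.continuous_eval G).continuousOn
    let c : ℂ := ((|B| + 1 : ℝ) : ℂ)
    let P : Ideal (MvPolynomial (Fin (s + 1)) ℂ) := vanishingIdeal ℂ {fun _ => c}
    obtain ⟨Q, hQ, hQP⟩ : ∃ Q : Ideal (MvPolynomial (Fin n) ℂ ⧸ I), Q.IsMaximal ∧
        Q.comap (g : _ →+* _) = P := by
      let := (g : MvPolynomial (Fin (s + 1)) ℂ →+* (MvPolynomial (Fin n) ℂ ⧸ I)).toAlgebra
      have : Algebra.IsIntegral (MvPolynomial (Fin (s + 1)) ℂ) (MvPolynomial (Fin n) ℂ ⧸ I) :=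
        ⟨hint⟩
      refine Ideal.exists_ideal_over_maximal_of_isIntegral P ?_
      exact ((RingHom.injective_iff_ker_eq_bot _).mp hinj).le.trans bot_le
    have hmax : (Q.comap (Ideal.Quotient.mk I)).IsMaximal :=
      Ideal.comap_isMaximal_of_surjective _ Ideal.Quotient.mk_surjective
    obtain ⟨x, hx⟩ := isMaximal_iff_eq_vanishingIdeal_singleton.mp hmax
    have hxI : x ∈ zeroLocus ℂ I := by
      intro p hp
      rw [← mem_vanishingIdeal_singleton_iff, ← hx, Ideal.mem_comap,
        Ideal.Quotient.eq_zero_iff_mem.mpr hp]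
      exact Q.zero_mem
    have hXc : (X 0 - C c : MvPolynomial (Fin (s + 1)) ℂ) ∈ P := by
      rw [mem_vanishingIdeal_singleton_iff]
      simp
    have hGc : G - C c ∈ vanishingIdeal ℂ {x} := by
      rw [← hx, Ideal.mem_comap, map_sub, hG]
      rw [← hQP, Ideal.mem_comap] at hXc
      convert hXc using 1
      rw [map_sub]
      congr 1
      exact (g.commutes c).symm
    rw [mem_vanishingIdeal_singleton_iff, map_sub, sub_eq_zero, aeval_C] at hGc
    have h1 := hB x (hI hxI)
    rw [← coe_aeval_eq_eval] at h1
    have h2 : ‖c‖ = |B| + 1 := by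
      rw [Complex.norm_real, Real.norm_of_nonneg (by positivity)]
    have h3 : ‖(aeval x) G‖ ≤ B := h1
    rw [hGc, Algebra.algebraMap_self, RingHom.id_apply, h2] at h3
    linarith [le_abs_self B]

/-! ### Automorphisms of `ℂ`. -/

open Cardinal in
/-- Two uncountable algebraically closed fields of the same cardinality, both containing the
countable domain `R`, are isomorphic over `R`. -/
theorem IsAlgClosed.exists_ringEquiv_of_countable {R K L : Type} [CommRing R] [Countable R]
    [Field K] [Field L] [IsAlgClosed K] [IsAlgClosed L] [Algebra R K] [Algebra R L]
    [FaithfulSMul R K] [FaithfulSMul R L] (hK : ℵ₀ < #K) (hKL : #K = #L) :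
    ∃ e : K ≃+* L, ∀ r : R, e (algebraMap R K r) = algebraMap R L r := by
  have : Nontrivial R := (algebraMap R K).domain_nontrivial
  obtain ⟨s, hs⟩ := exists_isTranscendenceBasis R K
  obtain ⟨t, ht⟩ := exists_isTranscendenceBasis R L
  have hst : #s = #t := by
    rw [← cardinal_eq_cardinal_transcendence_basis_of_aleph0_lt' _ hs (mk_le_aleph0) hK,
      ← cardinal_eq_cardinal_transcendence_basis_of_aleph0_lt' _ ht (mk_le_aleph0) (hKL ▸ hK), hKL]
  obtain ⟨e⟩ := Cardinal.eq.mp hst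
  let := isAlgClosure_of_transcendence_basis _ hs
  let := isAlgClosure_of_transcendence_basis _ ht
  let ε : Algebra.adjoin R (Set.range ((↑) : s → K)) ≃ₐ[R]
      Algebra.adjoin R (Set.range ((↑) : t → L)) :=
    hs.1.aevalEquiv.symm.trans ((MvPolynomial.renameEquiv R e).trans ht.1.aevalEquiv)
  refine ⟨IsAlgClosure.equivOfEquiv K L ε.toRingEquiv, fun r => ?_⟩
  rw [IsScalarTower.algebraMap_apply R (Algebra.adjoin R (Set.range ((↑) : s → K))) K,
    IsAlgClosure.equivOfEquiv_algebraMap]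
  rw [IsScalarTower.algebraMap_apply R (Algebra.adjoin R (Set.range ((↑) : t → L))) L]
  congr 1
  exact ε.commutes r

open Cardinal in
theorem MvPolynomial.countable_of_countable {σ K : Type} [Countable σ] [CommSemiring K]
    [Countable K] : Countable (MvPolynomial σ K) :=
  Cardinal.mk_le_aleph0_iff.mp <| MvPolynomial.cardinalMk_le_max.trans <|
    max_le (max_le mk_le_aleph0 mk_le_aleph0) le_rfl

open Cardinal in
/-- Two tuples of complex numbers, each algebraically independent over a countable field `K`, are
conjugate under an automorphism of `ℂ` over `K`. -/
theorem Complex.exists_ringEquiv_of_algebraicIndependent {n : ℕ} {K : Type} [Field K] [Countable K]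
    [Algebra K ℂ] {x y : Fin n → ℂ} (hx : AlgebraicIndependent K x)
    (hy : AlgebraicIndependent K y) :
    ∃ σ : ℂ ≃+* ℂ, (∀ a : K, σ (algebraMap K ℂ a) = algebraMap K ℂ a) ∧ ∀ i, σ (x i) = y i := by
  have : Countable (MvPolynomial (Fin n) K) := MvPolynomial.countable_of_countable
  have hcard : ℵ₀ < #ℂ := by
    rw [Cardinal.mk_complex]; exact Cardinal.aleph0_lt_continuum
  -- Evaluation at `x` and at `y` gives two `K[X]`-algebra structures on `ℂ`, faithful by
  -- independence; an isomorphism between them sends `x` to `y`.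
  let ax : Algebra (MvPolynomial (Fin n) K) ℂ := (MvPolynomial.aeval x).toRingHom.toAlgebra
  let ay : Algebra (MvPolynomial (Fin n) K) ℂ := (MvPolynomial.aeval y).toRingHom.toAlgebra
  have fx : @FaithfulSMul (MvPolynomial (Fin n) K) ℂ ax.toSMul :=
    (@faithfulSMul_iff_algebraMap_injective (MvPolynomial (Fin n) K) ℂ _ _ ax).mpr hx
  have fy : @FaithfulSMul (MvPolynomial (Fin n) K) ℂ ay.toSMul :=
    (@faithfulSMul_iff_algebraMap_injective (MvPolynomial (Fin n) K) ℂ _ _ ay).mpr hy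
  obtain ⟨e, he⟩ := @IsAlgClosed.exists_ringEquiv_of_countable (MvPolynomial (Fin n) K) ℂ ℂ _ _ _ _
    _ _ ax ay fx fy hcard rfl
  have he' : ∀ r : MvPolynomial (Fin n) K, e (MvPolynomial.aeval x r) = MvPolynomial.aeval y r := he
  exact ⟨e, fun a => by simpa using he' (MvPolynomial.C a),
    fun i => by simpa using he' (MvPolynomial.X i)⟩

/-! ### Polarization and Hermitian symmetry. -/

open MvPolynomial in
/-- A complex polynomial in two groups of variables that vanishes on the antidiagonal
`{(z, z̄)}` is zero. -/
theorem PolarPoly.eq_zero_of_polarEval_self {n : ℕ} {D : PolarPoly n}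
    (h : ∀ z, D.polarEval z z = 0) : D = 0 := by
  -- In the coordinates `z = x + iy`, `ζ = x - iy` the antidiagonal becomes the set of real points.
  let E : PolarPoly n := bind₁ (Sum.elim
    (fun i => X (Sum.inl i) + C Complex.I * X (Sum.inr i))
    (fun i => X (Sum.inl i) - C Complex.I * X (Sum.inr i))) D
  have hE (x y : Fin n → ℂ) : eval (Sum.elim x y) E =
      eval (Sum.elim (fun i => x i + Complex.I * y i) (fun i => x i - Complex.I * y i)) D := by
    simp only [E]
    rw [← coe_aeval_eq_eval, RingHom.coe_coe, aeval_bind₁, ← coe_aeval_eq_eval, RingHom.coe_coe]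
    congr 2
    ext (i | i) <;> simp
  have hE0 : E = 0 := by
    refine funext_set (fun _ => Set.range ((↑) : ℝ → ℂ))
      (fun _ => Set.infinite_range_of_injective Complex.ofReal_injective) fun x hx => ?_
    choose r hr using fun i => hx i trivial
    have hx' : x = Sum.elim (fun i => (r (Sum.inl i) : ℂ)) (fun i => (r (Sum.inr i) : ℂ)) := by
      ext (i | i) <;> simp [hr]
    rw [hx', hE, map_zero, ← h fun i => (r (Sum.inl i) : ℂ) + Complex.I * r (Sum.inr i)]
    unfold PolarPoly.polarEval
    congr 2
    ext (i | i) <;> simp [sub_eq_add_neg]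
  refine MvPolynomial.funext fun x => ?_
  have := hE (fun i => (x (Sum.inl i) + x (Sum.inr i)) / 2)
    (fun i => (x (Sum.inl i) - x (Sum.inr i)) / (2 * Complex.I))
  rw [hE0, map_zero] at this
  rw [map_zero, this]
  congr 2
  ext (i | i) <;> simp <;> field_simp <;> ring

open MvPolynomial in
/-- The complexification of a real polynomial is Hermitian: `P(w, z̄)` is the conjugate of
`P(z, w̄)`. -/
theorem PolarPoly.IsReal.star_polarEval {n : ℕ} {P : PolarPoly n} (hP : P.IsReal)
    (z w : Fin n → ℂ) : star (P.polarEval z w) = P.polarEval w z := by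
  let P' : PolarPoly n := rename Sum.swap (map (starRingEnd ℂ) P)
  have hP' (z w : Fin n → ℂ) : P'.polarEval w z = star (P.polarEval z w) := by
    simp only [P', PolarPoly.polarEval, eval_rename]
    rw [eval_map, ← eval₂_id]
    change _ = starRingEnd ℂ _
    rw [eval₂_comp_left, RingHom.comp_id]
    congr 1
    ext (i | i) <;> simp
  have hsub : P - P' = 0 := by
    refine PolarPoly.eq_zero_of_polarEval_self fun z => ?_
    have h1 : (P - P').polarEval z z = P.polarEval z z - P'.polarEval z z := map_sub _ _ _
    rw [h1, hP', sub_eq_zero]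
    exact (Complex.conj_eq_iff_im.mpr (hP z)).symm
  rw [← hP', ← sub_eq_zero.mp hsub]

theorem PolarPoly.IsReal.polarEval_eq_zero_comm {n : ℕ} {P : PolarPoly n} (hP : P.IsReal)
    (z w : Fin n → ℂ) : P.polarEval z w = 0 ↔ P.polarEval w z = 0 := by
  rw [← hP.star_polarEval, star_eq_zero]

/-! ### Generic points on the hypersurface. -/

open MvPolynomial in
/-- A polynomial that does not vanish at `a` has finitely many zeros on a line through `a`. -/
theorem MvPolynomial.finite_setOf_eval_line_eq_zero {n : ℕ} {f : MvPolynomial (Fin n) ℂ}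
    {a v : Fin n → ℂ} (ha : eval a f ≠ 0) : {c : ℂ | eval (a + c • v) f = 0}.Finite := by
  let g : Polynomial ℂ := aeval (fun i => Polynomial.C (a i) + Polynomial.C (v i) * Polynomial.X) f
  have hg (c : ℂ) : g.eval c = eval (a + c • v) f := by
    have h : (Polynomial.aeval c).comp (aeval fun i => Polynomial.C (a i) +
        Polynomial.C (v i) * Polynomial.X) = aeval (R := ℂ) (a + c • v) := by
      ext i
      simp
      exact mul_comm _ _
    exact DFunLike.congr_fun h f
  have hg0 : g ≠ 0 := by
    rintro h
    apply ha
    have := hg 0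
    rwa [h, Polynomial.eval_zero, zero_smul, add_zero, eq_comm] at this
  refine (Polynomial.finite_setOfPred_isRoot hg0).subset fun c hc => ?_
  exact (hg c).trans hc

open Filter Topology in
/-- A point of a smooth real hypersurface can be chosen outside countably many proper complex
algebraic subsets. -/
theorem IsSmoothRealHypersurface.exists_eval_ne_zero {n : ℕ} {Γ : Set (Fin n → ℂ)}
    (hΓ : IsSmoothRealHypersurface Γ) (hne : Γ.Nonempty) {F : Set (MvPolynomial (Fin n) ℂ)}
    (hF : F.Countable)
    (hae : ∀ᵐ z : Fin n → ℂ, ∀ f ∈ F, MvPolynomial.eval z f ≠ 0) :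
    ∃ q ∈ Γ, ∀ f ∈ F, MvPolynomial.eval q f ≠ 0 := by
  obtain ⟨p, hp⟩ := hne
  obtain ⟨V, ρ, hV, hpV, hρ, hdρ, hVΓ⟩ := hΓ p hp
  have hρp : ρ p = 0 := (hVΓ p hpV).mp hp
  obtain ⟨v, hv⟩ : ∃ v, 0 < fderiv ℝ ρ p v := by
    obtain ⟨v, hv⟩ := DFunLike.ne_iff.mp hdρ
    rcases lt_or_gt_of_ne hv with h | h
    · exact ⟨-v, by rw [map_neg]; exact neg_pos.mpr h⟩
    · exact ⟨v, h⟩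
  have hdiff : DifferentiableAt ℝ ρ p :=
    (hρ.contDiffAt (hV.mem_nhds hpV)).differentiableAt (by simp)
  have hline : HasDerivAt (fun r : ℝ => ρ (p + r • v)) (fderiv ℝ ρ p v) 0 := by
    have h1 : HasDerivAt (fun r : ℝ => p + r • v) v 0 := by
      simpa using ((hasDerivAt_id (0 : ℝ)).smul_const v).const_add p
    have h2 : HasFDerivAt ρ (fderiv ℝ ρ p) (p + (0 : ℝ) • v) := by
      simpa using hdiff.hasFDerivAt
    exact h2.comp_hasDerivAt (0 : ℝ) h1
  obtain ⟨ε, hε, hεV⟩ := Metric.isOpen_iff.mp hV p hpV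
  have hpos : ∀ᶠ r : ℝ in 𝓝[>] 0, 0 < ρ (p + r • v) ∧ ρ (p - r • v) < 0 ∧ ‖r • v‖ < ε / 2 := by
    have hslope := eventually_nhdsWithin_iff.mp
      ((hasDerivAt_iff_tendsto_slope.mp hline).eventually (lt_mem_nhds hv))
    have hneg : Tendsto (fun r : ℝ => -r) (𝓝 0) (𝓝 0) := by
      simpa using (continuous_neg (G := ℝ)).tendsto 0
    have hsmall : ∀ᶠ r : ℝ in 𝓝 0, ‖r • v‖ < ε / 2 := by
      refine ContinuousAt.eventually_lt (by fun_prop) continuousAt_const ?_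
      simpa using hε
    refine eventually_nhdsWithin_iff.mpr ?_
    filter_upwards [hslope, hneg.eventually hslope, hsmall] with r h1 h2 h3 hr
    have hr : 0 < r := hr
    have h1 := h1 hr.ne'
    have h2 := h2 (neg_ne_zero.mpr hr.ne')
    simp only [slope_def_field, zero_smul, add_zero, hρp, sub_zero] at h1 h2
    refine ⟨(div_pos_iff_of_pos_right hr).mp h1, ?_, h3⟩
    rw [neg_smul, ← sub_eq_add_neg, div_neg, neg_pos] at h2
    exact not_le.mp fun hge => h2.not_ge (div_nonneg hge hr.le)
  obtain ⟨s, ⟨hs1, hs2, hs3⟩, hs⟩ := (hpos.and self_mem_nhdsWithin).exists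
  have hs : 0 < s := hs
  have hρcont : ContinuousOn ρ V := hρ.continuousOn
  have hnear : ∀ᶠ z in 𝓝 p, 0 < ρ (z + s • v) ∧ ρ (z - s • v) < 0 ∧ z ∈ Metric.ball p (ε / 2) := by
    have hV1 : p + s • v ∈ V := hεV (by simp; linarith)
    have hV2 : p - s • v ∈ V := hεV (by simp; linarith)
    have hc1 : ContinuousAt (fun z => ρ (z + s • v)) p :=
      ContinuousAt.comp (f := fun z => z + s • v) (hρcont.continuousAt (hV.mem_nhds hV1))
        (by fun_prop)
    have hc2 : ContinuousAt (fun z => ρ (z - s • v)) p :=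
      ContinuousAt.comp (f := fun z => z - s • v) (hρcont.continuousAt (hV.mem_nhds hV2))
        (by fun_prop)
    exact (continuousAt_const.eventually_lt hc1 hs1).and
      ((hc2.eventually_lt continuousAt_const hs2).and (Metric.ball_mem_nhds p (by positivity)))
  -- `ρ` changes sign along `v`, so every real line in direction `v` through a point near `p` meets
  -- `Γ`.
  have hcross : ∀ᶠ z in 𝓝 p, ∃ r : ℝ, z + r • v ∈ Γ := by
    filter_upwards [hnear] with z ⟨h1, h2, h3⟩
    have hmem : ∀ r ∈ Set.Icc (-s) s, z + r • v ∈ V := by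
      intro r hr
      apply hεV
      have h4 : ‖r • v‖ ≤ ‖s • v‖ := by
        rw [norm_smul, norm_smul, Real.norm_of_nonneg hs.le]
        exact mul_le_mul_of_nonneg_right (abs_le.mpr hr) (norm_nonneg v)
      rw [Metric.mem_ball, dist_eq_norm] at h3 ⊢
      calc ‖z + r • v - p‖ = ‖(z - p) + r • v‖ := by congr 1; abel
        _ ≤ ‖z - p‖ + ‖r • v‖ := norm_add_le _ _
        _ < ε := by linarith
    have hcont : ContinuousOn (fun r : ℝ => ρ (z + r • v)) (Set.Icc (-s) s) :=
      hρcont.comp (by fun_prop) hmem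
    obtain ⟨r, hr, hr0⟩ := intermediate_value_Icc (by linarith) hcont
      (show (0 : ℝ) ∈ Set.Icc _ _ from ⟨by simpa [← sub_eq_add_neg] using h2.le, h1.le⟩)
    exact ⟨r, (hVΓ _ (hmem r hr)).mpr hr0⟩
  obtain ⟨W, hWsub, hWo, hpW⟩ := eventually_nhds_iff.mp hcross
  obtain ⟨a, haW, ha⟩ := (Measure.dense_of_ae hae).inter_open_nonempty _ hWo ⟨p, hpW⟩
  -- Each `f ∈ F` has finitely many zeros on the complex line `a + ℂv`. If `t` avoids their
  -- imaginary parts, the real line `a + itv + ℝv` has no zeros, and for small `t` it meets `Γ`.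
  have htrans : ∀ᶠ t : ℝ in 𝓝 0, a + (t * Complex.I : ℂ) • v ∈ W := by
    have hc : Continuous fun t : ℝ => a + (t * Complex.I : ℂ) • v := by fun_prop
    exact hc.continuousAt.eventually (hWo.mem_nhds (by simpa using haW))
  obtain ⟨δ, hδ, hδW⟩ := Metric.eventually_nhds_iff.mp htrans
  have hcount : (⋃ f ∈ F, Complex.im '' {c : ℂ | MvPolynomial.eval (a + c • v) f = 0}).Countable :=
    hF.biUnion fun f hf =>
      ((MvPolynomial.finite_setOf_eval_line_eq_zero (ha f hf)).image _).countable
  obtain ⟨t, ht, htF⟩ : ∃ t ∈ Set.Ioo (-δ) δ,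
      t ∉ ⋃ f ∈ F, Complex.im '' {c : ℂ | MvPolynomial.eval (a + c • v) f = 0} := by
    by_contra! hcon
    have hIoo : (Set.Ioo (-δ) δ).Countable := hcount.mono hcon
    rw [← Cardinal.le_aleph0_iff_set_countable, Cardinal.mk_Ioo_real (by linarith)] at hIoo
    exact absurd hIoo Cardinal.aleph0_lt_continuum.not_ge
  obtain ⟨r, hr⟩ := hWsub _ (hδW (y := t) (by simpa [abs_lt] using ht))
  refine ⟨_, hr, fun f hf hzero => htF ?_⟩
  simp only [Set.mem_iUnion]
  refine ⟨f, hf, t * Complex.I + r, ?_, by simp⟩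
  rw [Set.mem_ofPred_eq, add_smul, ← add_assoc]
  exact hzero

/-- Tuples whose conjugates are algebraically independent over a countable field are the points
outside countably many proper algebraic subsets. -/
theorem Complex.exists_countable_forall_algebraicIndependent_star (n : ℕ) (K : Type) [Field K]
    [Countable K] [Algebra K ℂ] : ∃ F : Set (MvPolynomial (Fin n) ℂ), F.Countable ∧
      (∀ f ∈ F, f ≠ 0) ∧ ∀ z : Fin n → ℂ, (∀ f ∈ F, MvPolynomial.eval z f ≠ 0) →
        AlgebraicIndependent K (star z) := by
  have : Countable (MvPolynomial (Fin n) K) := MvPolynomial.countable_of_countable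
  let φ : K →+* ℂ := (starRingEnd ℂ).comp (algebraMap K ℂ)
  refine ⟨MvPolynomial.map φ '' {p | p ≠ 0}, (Set.to_countable _).image _, ?_, fun z hz => ?_⟩
  · rintro _ ⟨p, hp, rfl⟩
    exact (map_ne_zero_iff _ (MvPolynomial.map_injective φ φ.injective)).mpr hp
  · refine algebraicIndependent_iff.mpr fun p hp => ?_
    by_contra hp0
    refine hz _ ⟨p, hp0, rfl⟩ ?_
    have h := congrArg (starRingEnd ℂ) hp
    rw [MvPolynomial.aeval_def, MvPolynomial.eval₂_comp_left, map_zero] at h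
    rw [MvPolynomial.eval_map, ← h]
    congr 1
    ext i
    simp

/-! ### Segre fibres. -/

/-- Conjugating a point by an automorphism of `ℂ` fixing the coefficients of `P` does not change
the cardinality of its Segre fibre. -/
theorem PolarPoly.encard_segreFiber_eq_of_ringEquiv {n : ℕ} {P : PolarPoly n} (σ : ℂ ≃+* ℂ)
    (hσ : MvPolynomial.map (σ : ℂ →+* ℂ) P = P) {z w : Fin n → ℂ}
    (hzw : ∀ i, σ (star (z i)) = star (w i)) :
    (P.segreFiber z).encard = (P.segreFiber w).encard := by
  let e : (Fin n → ℂ) ≃ (Fin n → ℂ) := Equiv.piCongrRight fun _ => σ.toEquiv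
  let s : (Fin n → ℂ) ≃ (Fin n → ℂ) := Equiv.piCongrRight fun _ => starRingAut.toEquiv
  -- `w` enters `P(z, w̄)` through its conjugate, so parameters move by `σ` conjugated with complex
  -- conjugation, while `z` moves by `σ`.
  let τ : (Fin n → ℂ) ≃ (Fin n → ℂ) := (s.trans e).trans s
  have hτz : τ z = w := by
    ext i
    change star (σ (star (z i))) = w i
    rw [hzw, star_star]
  have heval (a b : Fin n → ℂ) : P.polarEval (e a) (τ b) = σ (P.polarEval a b) := by
    have h : σ (P.polarEval a b) =
        (σ : ℂ →+* ℂ) (MvPolynomial.eval₂ (RingHom.id ℂ) (Sum.elim a (star b)) P) := rfl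
    rw [h, MvPolynomial.eval₂_comp_left, RingHom.comp_id, ← MvPolynomial.eval_map, hσ]
    unfold PolarPoly.polarEval
    congr 2
    ext (i | i)
    · rfl
    · change star (star (σ (star (b i)))) = σ (star (b i))
      rw [star_star]
  have hvar (b : Fin n → ℂ) : P.segreVariety b = e ⁻¹' P.segreVariety (τ b) := by
    ext a
    change P.polarEval a b = 0 ↔ P.polarEval (e a) (τ b) = 0
    rw [heval, map_eq_zero_iff σ σ.injective]
  have hfib : P.segreFiber z = τ ⁻¹' P.segreFiber w := by
    ext b
    change P.segreVariety b = P.segreVariety z ↔ P.segreVariety (τ b) = P.segreVariety w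
    rw [hvar b, hvar z, hτz, (Set.preimage_injective.mpr e.surjective).eq_iff]
  rw [hfib, Set.encard_preimage_of_bijective τ.bijective]

/-- The points whose Segre variety contains that of `z` have conjugates forming an algebraic
set. -/
theorem PolarPoly.exists_zeroLocus_eq {n : ℕ} (P : PolarPoly n) (z : Fin n → ℂ) :
    ∃ I : Ideal (MvPolynomial (Fin n) ℂ), MvPolynomial.zeroLocus ℂ I =
      {x | P.segreVariety z ⊆ P.segreVariety (star x)} := by
  let g (a : Fin n → ℂ) : MvPolynomial (Fin n) ℂ :=
    MvPolynomial.bind₁ (Sum.elim (fun i => MvPolynomial.C (a i)) MvPolynomial.X) P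
  refine ⟨Ideal.span (g '' P.segreVariety z), ?_⟩
  rw [MvPolynomial.zeroLocus_span]
  ext x
  simp only [Set.forall_mem_image, Set.mem_ofPred_eq]
  refine forall₂_congr fun a _ => ?_
  have h : MvPolynomial.aeval x (g a) = P.polarEval a (star x) := by
    simp only [g, PolarPoly.polarEval, MvPolynomial.aeval_bind₁, star_star]
    rw [← MvPolynomial.coe_aeval_eq_eval, RingHom.coe_coe]
    congr 2
    ext (i | i) <;> simp
  rw [h]
  rfl

/-- The Segre fibre of a point of a compact real algebraic set is finite. -/
theorem PolarPoly.finite_segreFiber {n : ℕ} {P : PolarPoly n} (hP : P.IsReal)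
    (hc : IsCompact P.realZeroLocus) {z : Fin n → ℂ} (hz : z ∈ P.realZeroLocus) :
    (P.segreFiber z).Finite := by
  obtain ⟨I, hI⟩ := P.exists_zeroLocus_eq z
  have hfin : (MvPolynomial.zeroLocus ℂ I).Finite := by
    refine MvPolynomial.finite_zeroLocus_of_isCompact I (hc.image continuous_star) ?_
    rw [hI]
    intro x hx
    have h1 : z ∈ P.segreVariety (star x) := hx hz
    have h2 : star x ∈ P.segreVariety z := (hP.polarEval_eq_zero_comm _ _).mp h1
    exact ⟨star x, hx h2, star_star x⟩
  refine (hfin.image star).subset fun w hw => ⟨star w, ?_, star_star w⟩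
  rw [hI, Set.mem_ofPred_eq, star_star]
  exact (show P.segreVariety w = P.segreVariety z from hw).ge

theorem lemma2p1 (n : ℕ) (Γ : Set (Fin n → ℂ)) (P : PolarPoly n)
    (hP : P.IsReal) (hΓP : Γ = P.realZeroLocus)
    (hsmooth : IsSmoothRealHypersurface Γ) (hcompact : IsCompact Γ) :
    ∃ (U : Set (Fin n → ℂ)) (m : ℕ), IsOpen U ∧ Γ ⊆ U ∧ 1 ≤ m ∧
      ∀ᵐ z ∂((volume : Measure (Fin n → ℂ)).restrict U), (P.segreFiber z).encard = m := by
  rcases Γ.eq_empty_or_nonempty with hempty | hne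
  -- Without a point of `Γ` nothing bounds the fibres, so `U` is taken empty.
  · exact ⟨∅, 1, isOpen_empty, hempty.le, le_rfl, by simp⟩
  let K : Subfield ℂ := Subfield.closure (P.coeffs : Set ℂ)
  have hK : Countable K := by
    rw [← Cardinal.mk_le_aleph0_iff]
    exact (Subfield.cardinalMk_closure_le_max _).trans
      (max_le (Cardinal.le_aleph0_iff_set_countable.mpr P.coeffs.countable_toSet) le_rfl)
  obtain ⟨F, hF, hF0, hFind⟩ := Complex.exists_countable_forall_algebraicIndependent_star n K
  have hae : ∀ᵐ z : Fin n → ℂ, ∀ f ∈ F, MvPolynomial.eval z f ≠ 0 :=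
    (ae_ball_iff hF).mpr fun f hf => by
      simpa [ae_iff] using MvPolynomial.volume_zeros_eq_zero (hF0 f hf)
  obtain ⟨q, hq, hqF⟩ := hsmooth.exists_eval_ne_zero hne hF hae
  have hfin : (P.segreFiber q).Finite := by
    subst hΓP
    exact PolarPoly.finite_segreFiber hP hcompact hq
  refine ⟨Set.univ, (P.segreFiber q).ncard, isOpen_univ, Set.subset_univ _, ?_, ?_⟩
  · exact (Set.ncard_pos hfin).mpr ⟨q, rfl⟩
  · rw [Measure.restrict_univ, hfin.cast_ncard_eq]
    filter_upwards [hae] with z hz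
    obtain ⟨σ, hσK, hσ⟩ := Complex.exists_ringEquiv_of_algebraicIndependent (hFind z hz)
      (hFind q hqF)
    refine PolarPoly.encard_segreFiber_eq_of_ringEquiv σ ?_ hσ
    ext m
    rw [MvPolynomial.coeff_map]
    by_cases hm : MvPolynomial.coeff m P = 0
    · simp [hm]
    · exact hσK ⟨_, Subfield.subset_closure (MvPolynomial.coeff_mem_coeffs m hm)⟩
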